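/- Let $d\ge 1$, $0<\alpha\le 2$, $\sigma>0$ and $\nu\in[-1,1]$, with $\nu=0$ if $\alpha=1$. Let $\mathcal S_\alpha(\sigma,\nu)$ be the stable distribution with characteristic function $$\theta\mapsto\exp\Big(-\sigma^\alpha|\theta|^\alpha\big(1-i\nu\,\mathrm{sign}(\theta)\tan\tfrac{\pi\alpha}{2}\big)\Big).$$ Let $\xi=(\xi_k)_{k\in\mathbb Z^d}$ be i.i.d. real random variables satisfying $\mathbf H_\alpha$: their common law is in the normal domain of attraction of $\mathcal S_\alpha(\sigma,\nu)$, i.e. $n^{-1/\alpha}\sum_{i=1}^n Y_i\Rightarrow \mathcal S_\alpha(\sigma,\nu)$ as $n\to\infty$ for i.i.d. $Y_i$ with that law. A sum over $\mathbb Z^d$ of random variables $(X_k)_{k\in\mathbb Z^d}$ is said to converge a.s. if there is a random variable $X$ such that, for every increasing sequence $(S_n)$ of finite sets with union $\mathbb Z^d$, $\sum_{k\in S_n}X_k\to X$ almost surely (absolute convergence is not required). For $h>0$, let $\mu_h$ be the random signed measure on $\mathbb R^d$ with density $$\frac{d\mu_h}{dx}(x)=\gamma_h\sum_{k\in\mathbb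 Z^d}\xi_k\mathbf 1_{h(k+[0,1)^d)}(x),\qquad \gamma_h=\sigma^{-1}h^{(\frac1\alpha-1)d},$$ and let $\mathcal F_{\mu_h}$ be the set of $f\in L^1_{loc}(\mathbb R^d)$ for which $\int f\,d\mu_h$ converges a.s., in the sense that the sum over $k\in\mathbb Z^d$ of the integrals $\int_{h(k+[0,1)^d)}f\,d\mu_h$ converges a.s. Let $\mathcal D^\alpha(\mathbb R^d)$ be the set of $f\in L^1_{loc}(\mathbb R^d)$ such that $f(x)=o(|x|^{-\eta})$ as $|x|\to\infty$ for some $\eta>d/\alpha$. Then: 1. For $f:\mathbb Z^d\to\mathbb R$, the sum $\sum_{k}f_k\xi_k$ converges a.s. if and only if $f\in\ell^\alpha(\mathbb Z^d)$, i.e. $\sum_k|f_k|^\alpha<\infty$. Moreover, for every fixed increasing sequence $(S_n)$ of finite sets with union $\mathbb Z^d$, the sequence $\sum_{k\in S_n}f_k\xi_k$ converges almost surely if and only if $f\in\ell^\alpha(\mathbb Z^d)$. 2. If $1\le\alpha\le2$, then $L^\alpha(\mathbb R^d)\subset\mathcal F_{\mu_h}$ for every $h>0$. 3. If $0<\alpha<1$,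 then $\mathcal D^\alpha(\mathbb R^d)\subset\mathcal F_{\mu_h}$ for every $h>0$. -/

import Mathlib

open MeasureTheory ProbabilityTheory Filter Topology

noncomputable section

/-! ### Stable laws and the assumption on the innovations -/

/-- The Fourier transform of the stable distribution `S_α(σ, ν)`:
`exp (-σ^α |θ|^α (1 - i ν ε(θ) tan (π α / 2)))`, with `ε` the sign function. -/
def stableCharFun (α σ ν θ : ℝ) : ℂ :=
  Complex.exp (-((σ ^ α * |θ| ^ α : ℝ) : ℂ) *
    (1 - Complex.I * ((ν * Real.sign θ * Real.tan (Real.pi * α / 2) : ℝ) : ℂ)))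

/-- `m` is the stable distribution `S_α(σ, ν)`. -/
def IsStableLaw (α σ ν : ℝ) (m : ProbabilityMeasure ℝ) : Prop :=
  ∀ θ : ℝ, charFun (m : Measure ℝ) θ = stableCharFun α σ ν θ

/-- `ρ` is in the normal domain of attraction of `S_α(σ, ν)`: if `Y_1, …, Y_n` are i.i.d. with
law `ρ` (here the coordinates on `ℝ^n` under the product law), then
`n^(-1/α) (Y_1 + ⋯ + Y_n)` converges in distribution to `S_α(σ, ν)` as `n → ∞`. -/
def InNormalDomainOfAttraction (α σ ν : ℝ) (ρ : ProbabilityMeasure ℝ) : Prop :=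
  ∃ m : ProbabilityMeasure ℝ, IsStableLaw α σ ν m ∧
    TendstoInDistribution
      (fun (n : ℕ) (y : Fin n → ℝ) => (n : ℝ) ^ (-1 / α) * ∑ i, y i) atTop
      (fun x : ℝ => x) (fun n => Measure.pi (fun _ : Fin n => (ρ : Measure ℝ))) (m : Measure ℝ)

/-- The assumption `H_α` (with parameters `σ`, `ν`): the `ξ k`, `k ∈ ℤ^d`, are i.i.d. real random
variables whose common law is in the normal domain of attraction of `S_α(σ, ν)`. -/
structure HypH {Ω : Type*} [MeasurableSpace Ω] {d : ℕ} (α σ ν : ℝ)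
    (ξ : (Fin d → ℤ) → Ω → ℝ) (P : Measure Ω) : Prop where
  measurable : ∀ k, Measurable (ξ k)
  indep : iIndepFun ξ P
  law : ∃ ρ : ProbabilityMeasure ℝ, (∀ k, P.map (ξ k) = (ρ : Measure ℝ)) ∧
    InNormalDomainOfAttraction α σ ν ρ

/-! ### Almost sure semi-convergence of sums over `ℤ^d` -/

/-- An increasing sequence of finite subsets of `ℤ^d` with union `ℤ^d`. The initial segments of an
enumeration of `ℤ^d` and the boxes `{-n, …, n}^d` are examples. -/
def IsExhaustion {d : ℕ} (S : ℕ → Finset (Fin d → ℤ)) : Prop :=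
  Monotone S ∧ ∀ k, ∃ n, k ∈ S n

/-- Given random partial sums `I F`, for `F ⊆ ℤ^d` finite: there is a random variable `X` to which
the partial sums converge almost surely along every exhaustion of `ℤ^d` by finite sets (the
exceptional null set may depend on the exhaustion). -/
def SemiConvergesAS {Ω : Type*} [MeasurableSpace Ω] {d : ℕ} (P : Measure Ω)
    (I : Finset (Fin d → ℤ) → Ω → ℝ) : Prop :=
  ∃ X : Ω → ℝ, Measurable X ∧ ∀ S : ℕ → Finset (Fin d → ℤ), IsExhaustion S →
    ∀ᵐ ω ∂P, Tendsto (fun n => I (S n) ω) atTop (𝓝 (X ω))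

/-- The space `ℓ^α(ℤ^d)`. -/
def ellSpace (d : ℕ) (α : ℝ) : Set ((Fin d → ℤ) → ℝ) :=
  {f | Summable fun k => |f k| ^ α}

/-- The integrands of the random signed measure `∑_k ξ_k δ_k` on `ℤ^d`: the `f` for which
`∑_k f_k ξ_k` converges almost surely. -/
def latticeIntegrands {Ω : Type*} [MeasurableSpace Ω] {d : ℕ} (P : Measure Ω)
    (ξ : (Fin d → ℤ) → Ω → ℝ) : Set ((Fin d → ℤ) → ℝ) :=
  {f | SemiConvergesAS P (fun F ω => ∑ k ∈ F, f k * ξ k ω)}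

/-! ### The grid measures -/

/-- The cell `h (k + [0,1)^d)`. -/
def gridCell {d : ℕ} (h : ℝ) (k : Fin d → ℤ) : Set (EuclideanSpace ℝ (Fin d)) :=
  {x | ∀ i, h * (k i : ℝ) ≤ x i ∧ x i < h * ((k i : ℝ) + 1)}

/-- The normalisation `γ_h = σ⁻¹ h^((1/α - 1) d)`. -/
def gridNorm (d : ℕ) (α σ h : ℝ) : ℝ := σ⁻¹ * h ^ ((1 / α - 1) * (d : ℝ))

/-- The density `γ_h ∑_k ξ_k 1_{h (k + [0,1)^d)}` of the random signed measure `μ_h` at the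
outcome `ω`; at each point at most one term of the sum is nonzero. -/
def gridDensity {Ω : Type*} {d : ℕ} (α σ h : ℝ) (ξ : (Fin d → ℤ) → Ω → ℝ) (ω : Ω)
    (x : EuclideanSpace ℝ (Fin d)) : ℝ :=
  gridNorm d α σ h * ∑' k : Fin d → ℤ, (gridCell h k).indicator (fun _ => ξ k ω) x

/-- `∫_A f dμ_h` at the outcome `ω`, for a bounded region `A`. -/
def gridIntegralOn {Ω : Type*} {d : ℕ} (α σ h : ℝ) (ξ : (Fin d → ℤ) → Ω → ℝ)
    (f : EuclideanSpace ℝ (Fin d) → ℝ) (A : Set (EuclideanSpace ℝ (Fin d))) (ω : Ω) : ℝ :=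
  ∫ x in A, f x * gridDensity α σ h ξ ω x

/-- The integrands of `μ_h`: the locally integrable `f` for which `∫ f dμ_h` converges (as a
semi-convergent integral over growing finite unions of grid cells) almost surely. -/
def gridIntegrands {Ω : Type*} [MeasurableSpace Ω] {d : ℕ} (P : Measure Ω) (α σ h : ℝ)
    (ξ : (Fin d → ℤ) → Ω → ℝ) : Set (EuclideanSpace ℝ (Fin d) → ℝ) :=
  {f | LocallyIntegrable f volume ∧
    SemiConvergesAS P (fun F ω => gridIntegralOn α σ h ξ f (⋃ k ∈ F, gridCell h k) ω)}

/-- The decay class `D^α(ℝ^d)`: locally integrable functions with `f(x) = o(|x|^(-η))` as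
`|x| → ∞`, for some `η > d / α`. -/
def decayClass (d : ℕ) (α : ℝ) : Set (EuclideanSpace ℝ (Fin d) → ℝ) :=
  {f | LocallyIntegrable f volume ∧ ∃ η : ℝ, (d : ℝ) / α < η ∧
    f =o[cocompact (EuclideanSpace ℝ (Fin d))] fun x => ‖x‖ ^ (-η)}

end

/-!
Everything rests on the behaviour near `0` of the characteristic function `φ` of the innovations:
`‖1 - φ t‖ ≤ C |t| ^ α` for all `t`, and `c |t| ^ α ≤ 1 - ‖φ t‖` for small `t`. Both follow from the
convergence in law of the normalised sums, whose characteristic functions are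
`θ ↦ φ (n^(-1/α) θ) ^ n`: weak convergence makes these asymptotically equicontinuous, and the limit
has modulus `exp (-σ ^ α) < 1` at `θ = 1`. No logarithm of `φ` is taken. The upper bound comes from
a geometric sum (`norm_one_sub_mul_le_one_of_forall_pow`), the lower one from Bernoulli's
inequality.

If `f ∈ ℓ^α`, the upper bound controls the tails of the finite sums `∑ f_k ξ_k` by the tails of
`∑ |f_k| ^ α`, so that the sum is unconditionally Cauchy in probability. Ottaviani's inequality turns
this into almost sure convergence along each exhaustion
(`ae_exists_tendsto_sum_of_iIndepFun`), and the limit does not depend on the exhaustion because sums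
over symmetric differences vanish in probability (`semiConvergesAS_of_iIndepFun`).

Conversely, if the partial sums converge almost surely along one exhaustion, then `∏ ‖φ (f_k t)‖`
stays away from `0` for `|t| ≤ t₀`, so that the sums of `1 - ‖φ (f_k t)‖ ^ 2` are bounded. Averaging
over `t` shows that `f` is bounded off a finite set (`exists_finite_setOf_lt_abs`), and then the
lower bound on `1 - ‖φ‖` at one small `t` gives `f ∈ ℓ^α` (`summable_of_ae_exists_tendsto_sum`).

The integral of `f` against the grid measure is the lattice sum whose coefficients are, up to a
constant, the cell integrals of `f`. These are in `ℓ^α` by Jensen's inequality when `f ∈ L^α` and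
`1 ≤ α`, and by comparison with the integrable function `(1 + ‖x‖) ^ (-η α)`, where `η α > d`, when
`f` is in the decay class.
-/

/-! ### Characteristic functions along a weakly convergent sequence -/

lemma integrable_min_two_mul_abs (μ : Measure ℝ) [IsFiniteMeasure μ] (a : ℝ) :
    Integrable (fun x : ℝ => min 2 (|a| * |x|)) μ := by
  refine Integrable.of_bound (by fun_prop) 2 (ae_of_all _ fun x => ?_)
  rw [Real.norm_of_nonneg (by positivity)]
  exact min_le_left _ _

lemma norm_charFun_sub_charFun_le (μ : Measure ℝ) [IsProbabilityMeasure μ] (s t : ℝ) :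
    ‖charFun μ s - charFun μ t‖ ≤ ∫ x, min 2 (|s - t| * |x|) ∂μ := by
  have hint : ∀ s : ℝ, Integrable (fun x : ℝ => Complex.exp (s * x * Complex.I)) μ := fun s => by
    refine Integrable.of_bound (by fun_prop) 1 (ae_of_all _ fun x => ?_)
    rw [← Complex.ofReal_mul, Complex.norm_exp_ofReal_mul_I]
  rw [charFun_apply_real, charFun_apply_real, ← integral_sub (hint s) (hint t)]
  refine norm_integral_le_of_norm_le (integrable_min_two_mul_abs μ _) (ae_of_all _ fun x => ?_)
  refine le_min ?_ ?_
  · refine (norm_sub_le _ _).trans ?_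
    rw [← Complex.ofReal_mul, ← Complex.ofReal_mul, Complex.norm_exp_ofReal_mul_I,
      Complex.norm_exp_ofReal_mul_I]
    norm_num
  · have h : Complex.exp (s * x * Complex.I) - Complex.exp (t * x * Complex.I) =
        Complex.exp (t * x * Complex.I) *
          (Complex.exp (Complex.I * ((s - t) * x : ℝ)) - 1) := by
      rw [mul_sub, ← Complex.exp_add, mul_one]
      congr 2
      push_cast
      ring
    rw [h, norm_mul, ← Complex.ofReal_mul t x, Complex.norm_exp_ofReal_mul_I, one_mul, ← abs_mul]
    exact Real.norm_exp_I_mul_ofReal_sub_one_le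

/-- The characteristic functions of a weakly convergent sequence of laws are asymptotically
equicontinuous, uniformly on the line: the bound `𝔼 min (2, δ |X|)` of their oscillation at scale
`δ` is the expectation of a bounded continuous function, and it is small for the limit law. -/
lemma exists_eventually_norm_charFun_sub_lt {ι : Type*} {l : Filter ι}
    {μs : ι → ProbabilityMeasure ℝ} {μ : ProbabilityMeasure ℝ} (h : Tendsto μs l (𝓝 μ))
    {ε : ℝ} (hε : 0 < ε) :
    ∃ δ > 0, ∀ᶠ n in l, ∀ s t : ℝ, |s - t| ≤ δ →
      ‖charFun (μs n : Measure ℝ) s - charFun (μs n : Measure ℝ) t‖ < ε := by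
  have hlim : Tendsto (fun δ : ℝ => ∫ x, min 2 (|δ| * |x|) ∂(μ : Measure ℝ)) (𝓝 0)
      (𝓝 (∫ x, (0 : ℝ) ∂(μ : Measure ℝ))) := by
    refine tendsto_integral_filter_of_dominated_convergence (fun _ => 2)
      (Eventually.of_forall fun δ => by fun_prop)
      (Eventually.of_forall fun δ => ae_of_all _ fun x => ?_) (integrable_const _)
      (ae_of_all _ fun x => ?_)
    · rw [Real.norm_of_nonneg (by positivity)]
      exact min_le_left _ _
    · have : Continuous fun δ : ℝ => min 2 (|δ| * |x|) := by fun_prop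
      simpa using this.tendsto 0
  rw [integral_zero] at hlim
  obtain ⟨η, hη, hηlt⟩ := Metric.eventually_nhds_iff.1 (hlim.eventually_lt_const hε)
  have hδ := hηlt (y := η / 2) (by simp [abs_of_pos hη]; linarith)
  refine ⟨η / 2, by positivity, ?_⟩
  let g : BoundedContinuousFunction ℝ ℝ := BoundedContinuousFunction.ofNormedAddCommGroup
    (fun x : ℝ => min 2 (|η / 2| * |x|)) (by fun_prop) 2 (fun x => by
      rw [Real.norm_of_nonneg (by positivity)]
      exact min_le_left _ _)
  have hg := (ProbabilityMeasure.tendsto_iff_forall_integral_tendsto.1 h) g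
  filter_upwards [hg.eventually_lt_const hδ] with n hn s t hst
  refine (norm_charFun_sub_charFun_le _ s t).trans_lt (lt_of_le_of_lt ?_ hn)
  refine integral_mono (by simpa using integrable_min_two_mul_abs _ (s - t))
    (integrable_min_two_mul_abs _ _) fun x => ?_
  dsimp only [g]
  refine min_le_min le_rfl (mul_le_mul_of_nonneg_right ?_ (abs_nonneg x))
  exact hst.trans (le_abs_self _)

/-! ### The characteristic function of the innovations near the origin -/

/-- `n^(-1/α)` times the sum of `n` independent variables of law `ρ` has the characteristic
function `θ ↦ φ (n^(-1/α) θ) ^ n`, where `φ` is that of `ρ`. -/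
lemma InNormalDomainOfAttraction.exists_tendsto_charFun {α σ ν : ℝ} {ρ : ProbabilityMeasure ℝ}
    (h : InNormalDomainOfAttraction α σ ν ρ) :
    ∃ (μs : ℕ → ProbabilityMeasure ℝ) (m : ProbabilityMeasure ℝ), IsStableLaw α σ ν m ∧
      Tendsto μs atTop (𝓝 m) ∧ ∀ (n : ℕ) (θ : ℝ), charFun (μs n : Measure ℝ) θ =
        charFun (ρ : Measure ℝ) ((n : ℝ) ^ (-1 / α) * θ) ^ n := by
  obtain ⟨m, hm, hd⟩ := h
  refine ⟨fun n => ⟨(Measure.pi fun _ : Fin n => (ρ : Measure ℝ)).map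
      (fun y => (n : ℝ) ^ (-1 / α) * ∑ i, y i),
    Measure.isProbabilityMeasure_map (hd.forall_aemeasurable n)⟩, m, hm, ?_, fun n θ => ?_⟩
  · have h1 : (⟨(m : Measure ℝ).map (fun x => x),
        Measure.isProbabilityMeasure_map hd.aemeasurable_limit⟩ : ProbabilityMeasure ℝ) = m :=
      Subtype.ext Measure.map_id
    exact hd.tendsto.mono_right (le_of_eq (congrArg 𝓝 h1))
  · refine (charFun_map_mul_comp (μ := Measure.pi fun _ : Fin n => (ρ : Measure ℝ))
      (f := fun y => ∑ i, y i) (by fun_prop) ((n : ℝ) ^ (-1 / α)) θ).trans ?_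
    rw [charFun_map_sum_pi_eq_prod]
    simp

/-- Geometric sum: if the powers of `z` up to the order `N` stay close to `1`, then `z` is within
`1 / N` of `1`. -/
lemma norm_one_sub_mul_le_one_of_forall_pow {z : ℂ} {N : ℕ}
    (h : ∀ j ≤ N, ‖z ^ j - 1‖ ≤ 1 / 2) : ‖1 - z‖ * N ≤ 1 := by
  have hsum : (N : ℝ) / 2 ≤ ‖∑ j ∈ Finset.range N, z ^ j‖ := by
    have h1 : (N : ℂ) = ∑ j ∈ Finset.range N, z ^ j - ∑ j ∈ Finset.range N, (z ^ j - 1) := by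
      simp
    have h2 : (N : ℝ) ≤ ‖∑ j ∈ Finset.range N, z ^ j‖ +
        ‖∑ j ∈ Finset.range N, (z ^ j - 1)‖ := by
      calc (N : ℝ) = ‖(N : ℂ)‖ := by simp
        _ ≤ _ := by
          conv_lhs => rw [h1]
          exact norm_sub_le _ _
    have h3 : ‖∑ j ∈ Finset.range N, (z ^ j - 1)‖ ≤ N * (1 / 2) := by
      refine (norm_sum_le_of_le _ fun j hj => h j (Finset.mem_range.1 hj).le).trans ?_
      simp
    linarith
  have h4 : ‖1 - z‖ * ‖∑ j ∈ Finset.range N, z ^ j‖ ≤ 1 / 2 := by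
    rw [← norm_mul, mul_neg_geom_sum, norm_sub_rev]
    exact h N le_rfl
  nlinarith [norm_nonneg (1 - z)]

/-- `N^(-1/α) (t N^(1/α)) = t`. -/
lemma rpow_neg_one_div_mul_mul_rpow {α t : ℝ} {N : ℕ} (hN : N ≠ 0) :
    (N : ℝ) ^ (-1 / α) * (t * (N : ℝ) ^ (1 / α)) = t := by
  rw [neg_div, Real.rpow_neg (Nat.cast_nonneg N)]
  field_simp

theorem InNormalDomainOfAttraction.exists_norm_one_sub_charFun_le {α σ ν : ℝ} (hα : 0 < α)
    {ρ : ProbabilityMeasure ℝ} (h : InNormalDomainOfAttraction α σ ν ρ) :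
    ∃ C > 0, ∀ t : ℝ, ‖1 - charFun (ρ : Measure ℝ) t‖ ≤ C * |t| ^ α := by
  obtain ⟨μs, m, -, hμ, hφ⟩ := h.exists_tendsto_charFun
  obtain ⟨δ, hδ, hev⟩ := exists_eventually_norm_charFun_sub_lt hμ (ε := 1 / 2) (by norm_num)
  obtain ⟨n₀, hn₀⟩ := eventually_atTop.1 hev
  set φ := charFun (ρ : Measure ℝ) with hφdef
  have hφc : Continuous φ := continuous_charFun
  have hφ0 : φ 0 = 1 := by simp [hφdef]
  -- The finitely many powers of order below `n₀` are handled by continuity at `0`.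
  have hsmall : ∀ᶠ t in 𝓝 (0 : ℝ), ∀ j ∈ Finset.range n₀, ‖φ t ^ j - 1‖ < 1 / 2 := by
    rw [Filter.eventually_all_finset]
    intro j _
    have hc : Continuous fun t => ‖φ t ^ j - 1‖ := by fun_prop
    have := hc.tendsto 0
    simp only [hφ0, one_pow, sub_self, norm_zero] at this
    exact this.eventually_lt_const (by norm_num)
  obtain ⟨η, hη, hηs⟩ := Metric.eventually_nhds_iff.1 hsmall
  set κ := min δ η with hκ
  have hκ0 : 0 < κ := lt_min hδ hη
  refine ⟨2 / κ ^ α, by positivity, fun t => ?_⟩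
  rcases eq_or_ne t 0 with rfl | ht
  · simp [hφ0, Real.zero_rpow hα.ne']
  have ht0 : 0 < |t| := abs_pos.2 ht
  rcases lt_or_ge |t| κ with htκ | htκ
  · set N := ⌊(κ / |t|) ^ α⌋₊ with hN
    have hx1 : 1 ≤ (κ / |t|) ^ α := by
      refine Real.one_le_rpow ?_ hα.le
      rw [le_div_iff₀ ht0]
      linarith
    have hpow : ∀ j ≤ N, ‖φ t ^ j - 1‖ ≤ 1 / 2 := by
      intro j hj
      rcases lt_or_ge j n₀ with hjn | hjn
      · refine (hηs ?_ j (Finset.mem_range.2 hjn)).le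
        simpa using htκ.trans_le (min_le_right _ _)
      · rcases Nat.eq_zero_or_pos j with rfl | hj0
        · simp
        have hle : (j : ℝ) ≤ (κ / |t|) ^ α :=
          (Nat.cast_le.2 hj).trans (Nat.floor_le (by positivity))
        have hroot : (j : ℝ) ^ (1 / α) ≤ κ / |t| := by
          rw [one_div]
          exact (Real.rpow_inv_le_iff_of_pos (by positivity) (by positivity) hα).2 hle
        have := hn₀ j hjn (t * (j : ℝ) ^ (1 / α)) 0 (by
          rw [sub_zero, abs_mul, abs_of_nonneg (a := (j : ℝ) ^ (1 / α)) (by positivity)]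
          calc |t| * (j : ℝ) ^ (1 / α) ≤ |t| * (κ / |t|) := by gcongr
            _ = κ := by field_simp
            _ ≤ δ := min_le_left _ _)
        rw [hφ, rpow_neg_one_div_mul_mul_rpow hj0.ne'] at this
        simpa using this.le
    have h1 := norm_one_sub_mul_le_one_of_forall_pow hpow
    have h2 : (κ / |t|) ^ α ≤ 2 * N := by
      have h3 := Nat.lt_floor_add_one ((κ / |t|) ^ α)
      have h4 : (1 : ℝ) ≤ N := by
        rw [hN]
        exact_mod_cast Nat.le_floor (by simpa using hx1)
      linarith
    rw [Real.div_rpow hκ0.le ht0.le] at h2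
    have hκα : 0 < κ ^ α := by positivity
    have htα : 0 < |t| ^ α := by positivity
    rw [div_mul_eq_mul_div, le_div_iff₀ hκα]
    rw [div_le_iff₀ htα] at h2
    calc ‖1 - φ t‖ * κ ^ α ≤ ‖1 - φ t‖ * (2 * N * |t| ^ α) := by gcongr
      _ = 2 * (‖1 - φ t‖ * N) * |t| ^ α := by ring
      _ ≤ 2 * 1 * |t| ^ α := by gcongr
      _ = _ := by ring
  · refine norm_one_sub_charFun_le_two.trans ?_
    rw [div_mul_eq_mul_div, le_div_iff₀ (by positivity)]
    gcongr

lemma norm_stableCharFun_one (α σ ν : ℝ) :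
    ‖stableCharFun α σ ν 1‖ = Real.exp (-σ ^ α) := by
  rw [stableCharFun, Complex.norm_exp]
  simp only [Complex.mul_re, Complex.neg_re, Complex.neg_im, Complex.sub_re, Complex.one_re,
    Complex.ofReal_re, Complex.ofReal_im, Complex.I_re, Complex.I_im]
  simp

/-- The lower counterpart of the previous bound: `‖φ t‖ ^ N` is bounded away from `1` for
`N = ⌊t^(-α)⌋`, because `t = θ N^(-1/α)` with `θ → 1` as `t → 0`. -/
theorem InNormalDomainOfAttraction.exists_mul_rpow_le_one_sub_norm_charFun {α σ ν : ℝ}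
    (hα : 0 < α) (hσ : 0 < σ) {ρ : ProbabilityMeasure ℝ}
    (h : InNormalDomainOfAttraction α σ ν ρ) :
    ∃ c > 0, ∃ δ > 0, ∀ t : ℝ, |t| ≤ δ → c * |t| ^ α ≤ 1 - ‖charFun (ρ : Measure ℝ) t‖ := by
  obtain ⟨μs, m, hm, hμ, hφ⟩ := h.exists_tendsto_charFun
  set q := Real.exp (-σ ^ α) with hq
  have hq1 : q < 1 := by
    rw [hq, Real.exp_lt_one_iff]
    have : 0 < σ ^ α := by positivity
    linarith
  obtain ⟨δ, hδ, hev⟩ :=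
    exists_eventually_norm_charFun_sub_lt hμ (ε := (1 - q) / 4) (by linarith)
  have hlim : Tendsto (fun n => ‖charFun (μs n : Measure ℝ) 1‖) atTop (𝓝 q) := by
    have h1 := (ProbabilityMeasure.tendsto_iff_tendsto_charFun.1 hμ 1).norm
    rwa [hm 1, norm_stableCharFun_one] at h1
  have hlt := hlim.eventually_lt_const (u := q + (1 - q) / 4) (by linarith)
  have hinv : Tendsto (fun t : ℝ => (t⁻¹) ^ α) (𝓝[>] 0) atTop :=
    (tendsto_rpow_atTop hα).comp tendsto_inv_nhdsGT_zero
  have hfloor : Tendsto (fun t : ℝ => ⌊(t⁻¹) ^ α⌋₊) (𝓝[>] 0) atTop :=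
    tendsto_nat_floor_atTop.comp hinv
  have hratio : Tendsto (fun t : ℝ => ((⌊(t⁻¹) ^ α⌋₊ : ℝ) / (t⁻¹) ^ α) ^ (1 / α)) (𝓝[>] 0)
      (𝓝 1) := by
    have := ((tendsto_nat_floor_div_atTop (R := ℝ)).comp hinv).rpow_const
      (p := 1 / α) (Or.inl one_ne_zero)
    simpa using this
  have hclose : ∀ᶠ t : ℝ in 𝓝[>] 0,
      |((⌊(t⁻¹) ^ α⌋₊ : ℝ) / (t⁻¹) ^ α) ^ (1 / α) - 1| ≤ δ := by
    have := hratio.eventually (Metric.closedBall_mem_nhds 1 hδ)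
    simpa [Real.dist_eq] using this
  have key : ∀ᶠ t : ℝ in 𝓝[>] 0,
      (1 - q) / 2 * |t| ^ α ≤ 1 - ‖charFun (ρ : Measure ℝ) t‖ := by
    filter_upwards [hclose, hfloor.eventually hev, hfloor.eventually hlt,
      hfloor.eventually (eventually_ne_atTop 0), self_mem_nhdsWithin] with t h1 h2 h3 h4 h5
    replace h5 : 0 < t := h5
    set N := ⌊(t⁻¹) ^ α⌋₊ with hN
    have hθ : ((N : ℝ) / (t⁻¹) ^ α) ^ (1 / α) = t * (N : ℝ) ^ (1 / α) := by
      rw [Real.div_rpow (by positivity) (by positivity), ← Real.rpow_mul (by positivity),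
        mul_one_div_cancel hα.ne', Real.rpow_one, div_inv_eq_mul, mul_comm]
    rw [hθ] at h1
    have h6 := h2 _ 1 h1
    rw [hφ, rpow_neg_one_div_mul_mul_rpow h4] at h6
    have h7 : ‖charFun (ρ : Measure ℝ) t‖ ^ N ≤ (1 + q) / 2 := by
      rw [← norm_pow]
      have := norm_sub_norm_le (charFun (ρ : Measure ℝ) t ^ N) (charFun (μs N : Measure ℝ) 1)
      linarith
    -- Bernoulli's inequality.
    have h8 := one_add_mul_le_pow (a := ‖charFun (ρ : Measure ℝ) t‖ - 1)
      (by linarith [norm_nonneg (charFun (ρ : Measure ℝ) t)]) N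
    rw [add_sub_cancel] at h8
    have h9 : (N : ℝ) ≤ (t⁻¹) ^ α := Nat.floor_le (by positivity)
    have h10 : ‖charFun (ρ : Measure ℝ) t‖ ≤ 1 := norm_charFun_le_one t
    have h11 : (1 - q) / 2 ≤ (t⁻¹) ^ α * (1 - ‖charFun (ρ : Measure ℝ) t‖) := by
      calc (1 - q) / 2 ≤ N * (1 - ‖charFun (ρ : Measure ℝ) t‖) := by linarith
        _ ≤ _ := mul_le_mul_of_nonneg_right h9 (by linarith)
    rw [Real.inv_rpow h5.le, inv_mul_eq_div, le_div_iff₀ (by positivity)] at h11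
    rwa [abs_of_pos h5]
  obtain ⟨η, hη, hηs⟩ := Metric.eventually_nhds_iff.1 (eventually_nhdsWithin_iff.1 key)
  refine ⟨(1 - q) / 2, by linarith, η / 2, by positivity, fun t ht => ?_⟩
  have habs : ‖charFun (ρ : Measure ℝ) t‖ = ‖charFun (ρ : Measure ℝ) |t|‖ := by
    rcases abs_choice t with h1 | h1 <;> rw [h1]
    rw [charFun_neg, RCLike.norm_conj]
  rcases eq_or_ne t 0 with rfl | ht0
  · simp [Real.zero_rpow hα.ne']
  have := hηs (y := |t|) (by simp; linarith) (abs_pos.2 ht0)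
  rwa [abs_abs, ← habs] at this

section

variable {Ω : Type*} [MeasurableSpace Ω] {P : Measure Ω}

/-! ### Sums of independent random variables -/

/-- **Ottaviani's inequality**. The independence of the increments is only needed in the form that
`U 0, …, U j` is independent of `U N - U j`. -/
theorem ottaviani_inequality [IsProbabilityMeasure P] {U : ℕ → Ω → ℝ}
    (hU : ∀ j, Measurable (U j)) {N : ℕ} {r ε : ℝ}
    (hind : ∀ j ≤ N, IndepFun (fun ω (i : Finset.Iic j) => U i ω)
      (fun ω => U N ω - U j ω) P)
    (hε : ∀ j ≤ N, P.real {ω | r < |U N ω - U j ω|} ≤ ε) :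
    (1 - ε) * P.real {ω | ∃ j ≤ N, 2 * r < |U j ω|} ≤ P.real {ω | r < |U N ω|} := by
  -- `A j`: the threshold `2 r` is exceeded at time `j` for the first time.
  set A : ℕ → Set Ω := fun j => {ω | 2 * r < |U j ω|} ∩ ⋂ i, ⋂ (_ : i < j), {ω | |U i ω| ≤ 2 * r}
    with hA
  set B : ℕ → Set Ω := fun j => {ω | r < |U N ω - U j ω|}ᶜ with hB
  have hAm : ∀ j, MeasurableSet (A j) := fun j =>
    (measurableSet_lt measurable_const (hU j).abs).inter
      (MeasurableSet.iInter fun i => MeasurableSet.iInter fun _ =>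
        measurableSet_le (hU i).abs measurable_const)
  have hBm' : ∀ j, MeasurableSet {ω | r < |U N ω - U j ω|} := fun j =>
    measurableSet_lt measurable_const ((hU N).sub (hU j)).abs
  have hBm : ∀ j, MeasurableSet (B j) := fun j => (hBm' j).compl
  have hAB : ∀ j ≤ N, P.real (A j ∩ B j) = P.real (A j) * P.real (B j) := fun j hj => by
    set V : Set (Finset.Iic j → ℝ) := {u | 2 * r < |u ⟨j, Finset.mem_Iic.2 le_rfl⟩|} ∩
      ⋂ i : Finset.Iic j, ⋂ (_ : (i : ℕ) < j), {u | |u i| ≤ 2 * r} with hV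
    have hVm : MeasurableSet V :=
      (measurableSet_lt measurable_const (by fun_prop)).inter
        (MeasurableSet.iInter fun i => MeasurableSet.iInter fun _ =>
          measurableSet_le (by fun_prop) measurable_const)
    have hWm : MeasurableSet {v : ℝ | r < |v|}ᶜ :=
      (measurableSet_lt measurable_const (by fun_prop)).compl
    have := (hind j hj).measure_inter_preimage_eq_mul V {v | r < |v|}ᶜ hVm hWm
    have hAe : (fun ω (i : Finset.Iic j) => U i ω) ⁻¹' V = A j := by
      ext ω
      simp only [hV, hA, Set.mem_preimage, Set.mem_inter_iff, Set.mem_ofPred_eq, Set.mem_iInter,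
        Subtype.forall, Finset.mem_Iic]
      exact and_congr_right fun _ => ⟨fun h i hi => h i hi.le hi, fun h i _ hi => h i hi⟩
    rw [hAe] at this
    simp only [measureReal_def, ← ENNReal.toReal_mul]
    exact congrArg _ this
  have hdisj : Set.PairwiseDisjoint (↑(Finset.range (N + 1))) fun j => A j ∩ B j := by
    have key : ∀ i j, i < j → Disjoint (A i ∩ B i) (A j ∩ B j) := fun i j hij =>
      Set.disjoint_left.2 fun ω hi hj => (show |U i ω| ≤ 2 * r from Set.mem_iInter₂.1 hj.1.2 i hij).not_gt
        (show 2 * r < |U i ω| from hi.1.1)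
    intro i _ j _ hij
    rcases lt_or_gt_of_ne hij with h | h
    · exact key i j h
    · exact (key j i h).symm
  have hcover : {ω | ∃ j ≤ N, 2 * r < |U j ω|} ⊆ ⋃ j ∈ Finset.range (N + 1), A j := by
    classical
    rintro ω ⟨j, hj, hjr⟩
    have hex : ∃ j, 2 * r < |U j ω| := ⟨j, hjr⟩
    simp only [Set.mem_iUnion, Finset.mem_range]
    exact ⟨Nat.find hex, by have := Nat.find_min' hex hjr; omega, Nat.find_spec hex,
      Set.mem_iInter₂.2 fun i hi => not_lt.1 (Nat.find_min hex hi)⟩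
  have hsub : (⋃ j ∈ Finset.range (N + 1), A j ∩ B j) ⊆ {ω | r < |U N ω|} := by
    intro ω hω
    simp only [Set.mem_iUnion] at hω
    obtain ⟨j, -, h1, h2⟩ := hω
    have h3 : |U N ω - U j ω| ≤ r := not_lt.1 h2
    have h4 := abs_sub_abs_le_abs_sub (U j ω) (U N ω)
    rw [abs_sub_comm] at h4
    have h5 : 2 * r < |U j ω| := h1.1
    show r < |U N ω|
    linarith
  rcases le_or_gt 1 ε with hε1 | hε1
  · exact (mul_nonpos_of_nonpos_of_nonneg (by linarith) measureReal_nonneg).trans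
      measureReal_nonneg
  calc (1 - ε) * P.real {ω | ∃ j ≤ N, 2 * r < |U j ω|}
      ≤ (1 - ε) * ∑ j ∈ Finset.range (N + 1), P.real (A j) :=
        mul_le_mul_of_nonneg_left ((measureReal_mono hcover (measure_ne_top P _)).trans
          (measureReal_biUnion_finset_le _ _)) (by linarith)
    _ = ∑ j ∈ Finset.range (N + 1), P.real (A j) * (1 - ε) := by
        rw [Finset.mul_sum]
        exact Finset.sum_congr rfl fun j _ => mul_comm _ _
    _ ≤ ∑ j ∈ Finset.range (N + 1), P.real (A j ∩ B j) := by
        refine Finset.sum_le_sum fun j hj => ?_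
        have hjN : j ≤ N := Nat.lt_succ_iff.1 (Finset.mem_range.1 hj)
        rw [hAB j hjN, hB]
        refine mul_le_mul_of_nonneg_left ?_ measureReal_nonneg
        rw [probReal_compl_eq_one_sub (hBm' j)]
        linarith [hε j hjN]
    _ = P.real (⋃ j ∈ Finset.range (N + 1), A j ∩ B j) :=
        (measureReal_biUnion_finset hdisj fun j _ => (hAm j).inter (hBm j)).symm
    _ ≤ _ := measureReal_mono hsub

/-- The joint family of sums over subsets `A i` of `F` is independent of the sum over a set `G`
disjoint from `F`. -/
lemma ProbabilityTheory.iIndepFun.indepFun_sums {ι κ : Type*} {X : ι → Ω → ℝ}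
    (hind : iIndepFun X P) (hX : ∀ k, Measurable (X k)) {F G : Finset ι} (hFG : Disjoint F G)
    {A : κ → Finset ι} (hA : ∀ i, A i ⊆ F) :
    IndepFun (fun ω i => ∑ k ∈ A i, X k ω) (fun ω => ∑ k ∈ G, X k ω) P := by
  classical
  have h := (hind.indepFun_finset F G hFG hX).comp
    (φ := fun (u : F → ℝ) i => ∑ k ∈ F.attach with k.1 ∈ A i, u k)
    (ψ := fun (v : G → ℝ) => ∑ k, v k) (by fun_prop) (by fun_prop)
  convert h using 1
  · ext ω i
    simp only [Function.comp_apply]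
    rw [Finset.sum_filter, Finset.sum_attach F fun k => if k ∈ A i then X k ω else 0,
      ← Finset.sum_filter]
    exact Finset.sum_congr (by ext k; simpa using fun hk => hA i hk) fun _ _ => rfl
  · ext ω
    exact (Finset.sum_coe_sort G fun k => X k ω).symm

/-- A sum of independent random variables which is Cauchy in probability, with respect to the finite
sets disjoint from a large one, converges almost surely along every increasing sequence of finite
sets that realises the Cauchy condition. -/
theorem ae_exists_tendsto_sum_of_iIndepFun [IsProbabilityMeasure P] {ι : Type*} {X : ι → Ω → ℝ}
    (hX : ∀ k, Measurable (X k)) (hind : iIndepFun X P) {S : ℕ → Finset ι} (hS : Monotone S)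
    (hC : ∀ r > 0, ∀ ε > 0, ∃ n, ∀ F : Finset ι, Disjoint (S n) F →
      P.real {ω | r < |∑ k ∈ F, X k ω|} ≤ ε) :
    ∀ᵐ ω ∂P, ∃ l : ℝ, Tendsto (fun n => ∑ k ∈ S n, X k ω) atTop (𝓝 l) := by
  classical
  have hTm : ∀ F : Finset ι, Measurable fun ω => ∑ k ∈ F, X k ω := fun F => by fun_prop
  have hosc : ∀ r > 0, ∀ᵐ ω ∂P, ∃ n, ∀ j,
      |∑ k ∈ S (n + j), X k ω - ∑ k ∈ S n, X k ω| ≤ 2 * r := by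
    intro r hr
    rw [ae_iff, ← measureReal_eq_zero_iff]
    refine le_antisymm (le_of_forall_pos_le_add fun ε hε => ?_) measureReal_nonneg
    obtain ⟨n, hn⟩ := hC r hr (min (ε / 2) (1 / 2)) (by positivity)
    set U : ℕ → Ω → ℝ := fun j ω => ∑ k ∈ S (n + j), X k ω - ∑ k ∈ S n, X k ω with hU
    have hUsum : ∀ j ω, U j ω = ∑ k ∈ S (n + j) \ S n, X k ω := fun j ω =>
      (Finset.sum_sdiff_eq_sub (hS (Nat.le_add_right n j))).symm
    have hUm : ∀ j, Measurable (U j) := fun j => (hTm _).sub (hTm _)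
    have hUinc : ∀ j N, j ≤ N → ∀ ω, U N ω - U j ω = ∑ k ∈ S (n + N) \ S (n + j), X k ω :=
      fun j N hjN ω => by
        rw [Finset.sum_sdiff_eq_sub (hS (Nat.add_le_add_left hjN n))]
        simp only [hU]
        ring
    have hbound : ∀ N, P.real {ω | ∃ j ≤ N, 2 * r < |U j ω|} ≤ ε := fun N => by
      have h := ottaviani_inequality (P := P) hUm (N := N) (r := r) (ε := min (ε / 2) (1 / 2))
        (fun j hj => by
          simp only [hUinc j N hj]
          have := hind.indepFun_sums hX (F := S (n + j) \ S n) (G := S (n + N) \ S (n + j))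
            (Finset.disjoint_left.2 fun k hk hk' =>
              (Finset.mem_sdiff.1 hk').2 (Finset.mem_sdiff.1 hk).1)
            (A := fun i : Finset.Iic j => S (n + i) \ S n)
            (fun i => Finset.sdiff_subset_sdiff
              (hS (Nat.add_le_add_left (Finset.mem_Iic.1 i.2) n)) le_rfl)
          exact (funext₂ fun ω i => hUsum i ω : (fun ω (i : Finset.Iic j) => U i ω) = _) ▸ this)
        (fun j hj => by
          simp only [hUinc j N hj]
          exact hn _ (Finset.disjoint_left.2 fun k hk hk' =>
            (Finset.mem_sdiff.1 hk').2 (hS (Nat.le_add_right n j) hk)))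
      have h2 : P.real {ω | r < |U N ω|} ≤ min (ε / 2) (1 / 2) := by
        simp only [hUsum]
        exact hn _ Finset.disjoint_sdiff
      have h3 := min_le_left (ε / 2) (1 / 2 : ℝ)
      have h4 := min_le_right (ε / 2) (1 / 2 : ℝ)
      nlinarith [measureReal_nonneg (μ := P) (s := {ω | ∃ j ≤ N, 2 * r < |U j ω|})]
    have hmono : Monotone fun N => {ω | ∃ j ≤ N, 2 * r < |U j ω|} :=
      fun N N' hN ω ⟨j, hj, h⟩ => ⟨j, hj.trans hN, h⟩
    have hlim := (ENNReal.tendsto_toReal (measure_ne_top P _)).comp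
      (tendsto_measure_iUnion_atTop (μ := P) hmono)
    have hunion : P.real (⋃ N, {ω | ∃ j ≤ N, 2 * r < |U j ω|}) ≤ ε :=
      le_of_tendsto' hlim hbound
    rw [zero_add]
    refine (measureReal_mono fun ω hω => ?_).trans hunion
    simp only [Set.mem_ofPred_eq, not_exists, not_forall, not_le] at hω
    obtain ⟨j, hj⟩ := hω n
    exact Set.mem_iUnion.2 ⟨j, j, le_rfl, hj⟩
  have hall : ∀ᵐ ω ∂P, ∀ q : ℕ, ∃ n, ∀ j,
      |∑ k ∈ S (n + j), X k ω - ∑ k ∈ S n, X k ω| ≤ 2 * (1 / ((q : ℝ) + 1)) :=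
    ae_all_iff.2 fun q => hosc _ (by positivity)
  filter_upwards [hall] with ω hω
  refine cauchySeq_tendsto_of_complete (Metric.cauchySeq_iff'.2 fun ε hε => ?_)
  obtain ⟨q, hq⟩ := exists_nat_one_div_lt (half_pos hε)
  obtain ⟨n, hn⟩ := hω q
  refine ⟨n, fun m hm => ?_⟩
  obtain ⟨j, rfl⟩ := Nat.exists_eq_add_of_le hm
  rw [Real.dist_eq]
  linarith [hn j]

/-! ### Characteristic functions of weighted sums -/

lemma charFun_map_sum_mul {ι : Type*} {ξ : ι → Ω → ℝ} (hm : ∀ k, Measurable (ξ k))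
    (hind : iIndepFun ξ P) {ρ : Measure ℝ} (hρ : ∀ k, P.map (ξ k) = ρ) (f : ι → ℝ)
    (F : Finset ι) (t : ℝ) :
    charFun (P.map fun ω => ∑ k ∈ F, f k * ξ k ω) t = ∏ k ∈ F, charFun ρ (f k * t) := by
  have h : iIndepFun (fun k ω => f k * ξ k ω) P :=
    hind.comp (fun k x => f k * x) fun k => by fun_prop
  rw [(h.restrict F).charFun_map_fun_finsetSum_eq_prod fun k _ => by fun_prop]
  simp only [Finset.prod_apply]
  exact Finset.prod_congr rfl fun k _ => by
    rw [charFun_map_mul_comp (hm k).aemeasurable, hρ]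

lemma norm_one_sub_prod_le {ι : Type*} (F : Finset ι) {z : ι → ℂ} (hz : ∀ k, ‖z k‖ ≤ 1) :
    ‖1 - ∏ k ∈ F, z k‖ ≤ ∑ k ∈ F, ‖1 - z k‖ := by
  classical
  induction F using Finset.induction_on with
  | empty => simp
  | insert a F ha ih =>
    rw [Finset.prod_insert ha, Finset.sum_insert ha,
      show 1 - z a * ∏ k ∈ F, z k = (1 - z a) + z a * (1 - ∏ k ∈ F, z k) by ring]
    refine (norm_add_le _ _).trans (add_le_add le_rfl ?_)
    rw [norm_mul]
    exact (mul_le_of_le_one_left (norm_nonneg _) (hz a)).trans ih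

/-- Tail bound for weighted sums: the tail at level `r` is controlled by `1 - φ` on the scale
`1 / r`. -/
lemma measureReal_lt_abs_sum_mul_le [IsProbabilityMeasure P] {ι : Type*} {ξ : ι → Ω → ℝ}
    (hm : ∀ k, Measurable (ξ k)) (hind : iIndepFun ξ P) {ρ : Measure ℝ}
    [IsProbabilityMeasure ρ] (hρ : ∀ k, P.map (ξ k) = ρ) {α C : ℝ} (hα : 0 < α) (hC0 : 0 ≤ C)
    (hC : ∀ t, ‖1 - charFun ρ t‖ ≤ C * |t| ^ α) (f : ι → ℝ) (F : Finset ι) {r : ℝ}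
    (hr : 0 < r) :
    P.real {ω | r < |∑ k ∈ F, f k * ξ k ω|} ≤
      2 * C * (2 * r⁻¹) ^ α * ∑ k ∈ F, |f k| ^ α := by
  have hSm : Measurable fun ω => ∑ k ∈ F, f k * ξ k ω := by fun_prop
  have : IsProbabilityMeasure (P.map fun ω => ∑ k ∈ F, f k * ξ k ω) :=
    Measure.isProbabilityMeasure_map hSm.aemeasurable
  have h1 := measureReal_abs_gt_le_integral_charFun
    (μ := P.map fun ω => ∑ k ∈ F, f k * ξ k ω) hr
  rw [map_measureReal_apply hSm (measurableSet_lt measurable_const (by fun_prop))] at h1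
  refine h1.trans ?_
  have h2 := intervalIntegral.norm_integral_le_of_norm_le_const
    (f := fun t => 1 - charFun (P.map fun ω => ∑ k ∈ F, f k * ξ k ω) t)
    (a := -2 * r⁻¹) (b := 2 * r⁻¹) (C := C * (2 * r⁻¹) ^ α * ∑ k ∈ F, |f k| ^ α) (by
      intro t ht
      rw [charFun_map_sum_mul hm hind hρ]
      refine (norm_one_sub_prod_le F fun k => norm_charFun_le_one _).trans ?_
      rw [Finset.mul_sum]
      refine Finset.sum_le_sum fun k _ => (hC _).trans ?_
      rw [abs_mul, Real.mul_rpow (abs_nonneg _) (abs_nonneg _), mul_assoc, mul_comm (|f k| ^ α)]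
      have ht' : |t| ≤ 2 * r⁻¹ := by
        have hr' : 0 < r⁻¹ := inv_pos.2 hr
        rw [Set.uIoc_of_le (by linarith)] at ht
        exact abs_le.2 ⟨by linarith [ht.1], ht.2⟩
      gcongr)
  calc _ ≤ 2⁻¹ * r * (C * (2 * r⁻¹) ^ α * (∑ k ∈ F, |f k| ^ α) *
        |2 * r⁻¹ - -2 * r⁻¹|) := by gcongr
    _ = _ := by
      rw [show 2 * r⁻¹ - -2 * r⁻¹ = 4 * r⁻¹ by ring, abs_of_pos (by positivity)]
      field_simp
      ring

/-! ### Convergence of `∑ f_k ξ_k` for `f ∈ ℓ^α` -/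

/-- For `f ∈ ℓ^α` the weighted sum is unconditionally Cauchy in probability. -/
lemma exists_finset_forall_disjoint_measureReal_le [IsProbabilityMeasure P] {ι : Type*}
    {ξ : ι → Ω → ℝ} (hm : ∀ k, Measurable (ξ k)) (hind : iIndepFun ξ P) {ρ : Measure ℝ}
    [IsProbabilityMeasure ρ] (hρ : ∀ k, P.map (ξ k) = ρ) {α C : ℝ} (hα : 0 < α) (hC0 : 0 < C)
    (hC : ∀ t, ‖1 - charFun ρ t‖ ≤ C * |t| ^ α) {f : ι → ℝ}
    (hf : Summable fun k => |f k| ^ α) {r ε : ℝ} (hr : 0 < r) (hε : 0 < ε) :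
    ∃ s : Finset ι, ∀ F : Finset ι, Disjoint s F →
      P.real {ω | r < |∑ k ∈ F, f k * ξ k ω|} ≤ ε := by
  set K := 2 * C * (2 * r⁻¹) ^ α with hK
  have hK0 : 0 < K := by positivity
  obtain ⟨s, hs⟩ := summable_iff_vanishing_norm.1 hf (ε / K) (by positivity)
  refine ⟨s, fun F hF => (measureReal_lt_abs_sum_mul_le hm hind hρ hα hC0.le hC f F hr).trans ?_⟩
  have h1 := (le_abs_self _).trans (hs F hF.symm).le
  calc K * ∑ k ∈ F, |f k| ^ α ≤ K * (ε / K) := by gcongr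
    _ = ε := by field_simp

lemma IsExhaustion.tendsto_atTop {d : ℕ} {S : ℕ → Finset (Fin d → ℤ)} (hS : IsExhaustion S) :
    Tendsto S atTop atTop :=
  tendsto_atTop_finset_of_monotone hS.1 hS.2

lemma isExhaustion_box (d : ℕ) :
    IsExhaustion fun n : ℕ => Fintype.piFinset fun _ : Fin d => Finset.Icc (-(n : ℤ)) n := by
  refine ⟨fun m n hmn => Fintype.piFinset_subset _ _ fun _ =>
    Finset.Icc_subset_Icc (by simpa) (by simpa), fun k => ⟨∑ i, (k i).natAbs, ?_⟩⟩
  simp only [Fintype.mem_piFinset, Finset.mem_Icc]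
  intro i
  have h : (k i).natAbs ≤ ∑ i, (k i).natAbs :=
    Finset.single_le_sum (f := fun i => (k i).natAbs) (fun _ _ => Nat.zero_le _)
      (Finset.mem_univ i)
  omega

/-- A sum of independent variables which is unconditionally Cauchy in probability semi-converges
almost surely: the limits along two exhaustions `S`, `T` agree because the sums over the two halves
of the symmetric differences of `S n` and `T n` tend to `0` in probability. -/
theorem semiConvergesAS_of_iIndepFun [IsProbabilityMeasure P] {d : ℕ} {X : (Fin d → ℤ) → Ω → ℝ}
    (hX : ∀ k, Measurable (X k)) (hind : iIndepFun X P)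
    (hC : ∀ r > 0, ∀ ε > 0, ∃ s : Finset (Fin d → ℤ), ∀ F : Finset (Fin d → ℤ), Disjoint s F →
      P.real {ω | r < |∑ k ∈ F, X k ω|} ≤ ε) :
    SemiConvergesAS P fun F ω => ∑ k ∈ F, X k ω := by
  classical
  have hTm : ∀ F : Finset (Fin d → ℤ), Measurable fun ω => ∑ k ∈ F, X k ω :=
    fun F => by fun_prop
  have hlim : ∀ S : ℕ → Finset (Fin d → ℤ), IsExhaustion S → ∃ Y : Ω → ℝ, Measurable Y ∧
      ∀ᵐ ω ∂P, Tendsto (fun n => ∑ k ∈ S n, X k ω) atTop (𝓝 (Y ω)) := fun S hS =>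
    measurable_limit_of_tendsto_metrizable_ae (fun n => (hTm (S n)).aemeasurable)
      (ae_exists_tendsto_sum_of_iIndepFun hX hind hS.1 fun r hr ε hε => by
        obtain ⟨s, hs⟩ := hC r hr ε hε
        obtain ⟨n, hn⟩ := (hS.tendsto_atTop.eventually_ge_atTop s).exists
        exact ⟨n, fun F hF => hs F (hF.mono_left hn)⟩)
  obtain ⟨Y, hYm, hY⟩ := hlim _ (isExhaustion_box d)
  refine ⟨Y, hYm, fun S hS => ?_⟩
  obtain ⟨Z, hZm, hZ⟩ := hlim S hS
  have hBx := isExhaustion_box d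
  set B : ℕ → Finset (Fin d → ℤ) :=
    fun n : ℕ => Fintype.piFinset fun _ : Fin d => Finset.Icc (-(n : ℤ)) n
  have h1 : TendstoInMeasure P (fun n ω => ∑ k ∈ S n, X k ω - ∑ k ∈ B n, X k ω) atTop
      fun ω => Z ω - Y ω := by
    refine tendstoInMeasure_of_tendsto_ae
      (fun n => ((hTm _).sub (hTm _)).aestronglyMeasurable) ?_
    filter_upwards [hY, hZ] with ω h1 h2 using h2.sub h1
  have h2 : TendstoInMeasure P (fun n ω => ∑ k ∈ S n, X k ω - ∑ k ∈ B n, X k ω) atTop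
      fun _ => 0 := by
    rw [tendstoInMeasure_iff_measureReal_norm]
    intro r hr
    refine tendsto_order.2 ⟨fun a ha => Eventually.of_forall fun n =>
      ha.trans_le measureReal_nonneg, fun a ha => ?_⟩
    obtain ⟨s, hs⟩ := hC (r / 3) (by positivity) (a / 3) (by positivity)
    filter_upwards [hS.tendsto_atTop.eventually_ge_atTop s,
      hBx.tendsto_atTop.eventually_ge_atTop s] with n hn1 hn2
    have hsub : {ω | r ≤ ‖∑ k ∈ S n, X k ω - ∑ k ∈ B n, X k ω - 0‖} ⊆
        {ω | r / 3 < |∑ k ∈ S n \ B n, X k ω|} ∪ {ω | r / 3 < |∑ k ∈ B n \ S n, X k ω|} := by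
      intro ω hω
      by_contra hcon
      simp only [Set.mem_union, Set.mem_ofPred_eq, not_or, not_lt] at hcon
      simp only [Set.mem_ofPred_eq, sub_zero, Real.norm_eq_abs] at hω
      rw [← Finset.sum_sdiff_sub_sum_sdiff] at hω
      have := abs_sub (∑ k ∈ S n \ B n, X k ω) (∑ k ∈ B n \ S n, X k ω)
      linarith
    have h3 := (measureReal_mono (μ := P) hsub).trans (measureReal_union_le _ _)
    have h4 := hs (S n \ B n) (Finset.disjoint_left.2 fun k hk hk' =>
      (Finset.mem_sdiff.1 hk').2 (hn2 hk))
    have h5 := hs (B n \ S n) (Finset.disjoint_left.2 fun k hk hk' =>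
      (Finset.mem_sdiff.1 hk').2 (hn1 hk))
    linarith
  filter_upwards [hZ, tendstoInMeasure_ae_unique h1 h2] with ω h3 h4
  rwa [← sub_eq_zero.1 h4]

/-! ### Necessity of `f ∈ ℓ^α` -/

/-- If the partial sums converge almost surely, then the products of the `‖φ (f_k t)‖` converge to
the modulus of the characteristic function of the limit, hence stay away from `0` for `t` in a
neighbourhood of `0`; this bounds the sums of `1 - ‖φ (f_k t)‖ ^ 2`. -/
lemma exists_forall_sum_one_sub_norm_charFun_sq_le [IsProbabilityMeasure P] {ι : Type*}
    {ξ : ι → Ω → ℝ} (hm : ∀ k, Measurable (ξ k)) (hind : iIndepFun ξ P) {ρ : Measure ℝ}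
    [IsProbabilityMeasure ρ] (hρ : ∀ k, P.map (ξ k) = ρ) {f : ι → ℝ} {S : ℕ → Finset ι}
    (hS : Tendsto S atTop atTop)
    (hconv : ∀ᵐ ω ∂P, ∃ l : ℝ, Tendsto (fun n => ∑ k ∈ S n, f k * ξ k ω) atTop (𝓝 l)) :
    ∃ t₀ > 0, ∀ t : ℝ, |t| ≤ t₀ → ∀ F : Finset ι,
      ∑ k ∈ F, (1 - ‖charFun ρ (f k * t)‖ ^ 2) ≤ 3 := by
  have hTm : ∀ n, Measurable fun ω => ∑ k ∈ S n, f k * ξ k ω := fun n => by fun_prop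
  obtain ⟨X, hXm, hX⟩ := measurable_limit_of_tendsto_metrizable_ae
    (fun n => (hTm n).aemeasurable) hconv
  have hPX : IsProbabilityMeasure (P.map X) := Measure.isProbabilityMeasure_map hXm.aemeasurable
  set χ := charFun (P.map X) with hχ
  have hlim : ∀ t : ℝ, Tendsto (fun n => ∏ k ∈ S n, ‖charFun ρ (f k * t)‖) atTop
      (𝓝 ‖χ t‖) := fun t => by
    have h1 : Tendsto (fun n => charFun (P.map fun ω => ∑ k ∈ S n, f k * ξ k ω) t) atTop
        (𝓝 (χ t)) := by
      have hcf : ∀ Y : Ω → ℝ, Measurable Y →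
          charFun (P.map Y) t = ∫ ω, Complex.exp (t * Y ω * Complex.I) ∂P := fun Y hY => by
        rw [charFun_apply_real, integral_map hY.aemeasurable (by fun_prop)]
      simp only [hχ, hcf X hXm, hcf _ (hTm _)]
      refine tendsto_integral_of_dominated_convergence (fun _ => 1)
        (fun n => by have := hTm n; fun_prop) (integrable_const _)
        (fun n => ae_of_all _ fun ω => ?_) ?_
      · rw [← Complex.ofReal_mul, Complex.norm_exp_ofReal_mul_I]
      · filter_upwards [hX] with ω hω
        have hc : Continuous fun x : ℝ => Complex.exp (t * x * Complex.I) := by fun_prop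
        exact (hc.tendsto (X ω)).comp hω
    simpa only [charFun_map_sum_mul hm hind hρ, norm_prod] using h1.norm
  have hχc : Continuous fun t => ‖χ t‖ := continuous_charFun.norm
  have hχ0 : ‖χ 0‖ = 1 := by simp [hχ]
  have hev : ∀ᶠ t in 𝓝 (0 : ℝ), 1 / 2 < ‖χ t‖ :=
    (hχc.tendsto 0).eventually_const_lt (by rw [hχ0]; norm_num)
  obtain ⟨η, hη, hηχ⟩ := Metric.eventually_nhds_iff.1 hev
  refine ⟨η / 2, by positivity, fun t ht F => ?_⟩
  have hχt : 1 / 2 < ‖χ t‖ := hηχ (by rw [Real.dist_eq, sub_zero]; linarith)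
  have hprod : 1 / 2 ≤ ∏ k ∈ F, ‖charFun ρ (f k * t)‖ :=
    hχt.le.trans (le_of_tendsto (hlim t) (by
      filter_upwards [hS.eventually_ge_atTop F] with n hn
      exact Finset.prod_le_prod_of_subset_of_le_one hn (fun _ _ => norm_nonneg _)
        fun _ _ _ => norm_charFun_le_one _))
  have hexp : ∏ k ∈ F, ‖charFun ρ (f k * t)‖ ^ 2 ≤
      Real.exp (-∑ k ∈ F, (1 - ‖charFun ρ (f k * t)‖ ^ 2)) := by
    rw [← Finset.sum_neg_distrib, Real.exp_sum]
    refine Finset.prod_le_prod (fun _ _ => by positivity) fun k _ => ?_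
    have := Real.add_one_le_exp (-(1 - ‖charFun ρ (f k * t)‖ ^ 2))
    linarith
  rw [Finset.prod_pow, Real.exp_neg] at hexp
  set s := ∑ k ∈ F, (1 - ‖charFun ρ (f k * t)‖ ^ 2)
  have h4 : (1 / 4 : ℝ) ≤ (Real.exp s)⁻¹ := by nlinarith
  have h5 := Real.add_one_le_exp s
  have h6 : Real.exp s ≤ 4 := by
    rw [le_inv_comm₀ (by norm_num) (Real.exp_pos s)] at h4
    linarith
  linarith

/-- A bound on the sums of `1 - ‖φ (f_k t)‖ ^ 2` for small `t` forces `f` to be bounded off a finite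
set. As `‖φ‖ ^ 2` is the characteristic function of the symmetrised law, the average of
`1 - ‖φ (f_k t)‖ ^ 2` over `|t| ≤ t₀` dominates a tail probability of that law, at a level which
decreases as `|f_k|` grows. -/
lemma exists_finite_setOf_lt_abs {ι : Type*} {ρ : Measure ℝ} [IsProbabilityMeasure ρ]
    (hnd : ∃ t, ‖charFun ρ t‖ ≠ 1) {f : ι → ℝ} {t₀ : ℝ} (ht₀ : 0 < t₀)
    (hsum : ∀ t : ℝ, |t| ≤ t₀ → ∀ F : Finset ι,
      ∑ k ∈ F, (1 - ‖charFun ρ (f k * t)‖ ^ 2) ≤ 3) :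
    ∃ M > 0, {k | M < |f k|}.Finite := by
  have hneg : IsProbabilityMeasure (ρ.map fun x => -1 * x) :=
    Measure.isProbabilityMeasure_map (by fun_prop)
  set ρs := ρ ∗ ρ.map (fun x => -1 * x) with hρs
  have hcf : ∀ t, charFun ρs t = ((‖charFun ρ t‖ ^ 2 : ℝ) : ℂ) := fun t => by
    rw [hρs, charFun_conv, charFun_map_mul, neg_one_mul, charFun_neg, Complex.mul_conj,
      Complex.normSq_eq_norm_sq]
  have hlev : ∃ r > 0, 0 < ρs.real {x | r < |x|} := by
    by_contra! hcon
    have hzero : ∀ᵐ x ∂ρs, x = 0 := by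
      have h1 : ∀ᵐ x ∂ρs, ∀ n : ℕ, |x| ≤ 1 / ((n : ℝ) + 1) := ae_all_iff.2 fun n => by
        rw [ae_iff, ← measureReal_eq_zero_iff]
        simp only [not_le]
        exact le_antisymm (hcon _ (by positivity)) measureReal_nonneg
      filter_upwards [h1] with x hx
      refine abs_nonpos_iff.1 (le_of_forall_pos_le_add fun ε hε => ?_)
      obtain ⟨n, hn⟩ := exists_nat_one_div_lt hε
      linarith [hx n]
    obtain ⟨t, ht⟩ := hnd
    have h2 : charFun ρs t = 1 := by
      rw [charFun_apply_real, integral_congr_ae (g := fun _ => (1 : ℂ))]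
      · simp
      · filter_upwards [hzero] with x hx
        simp [hx]
    rw [hcf] at h2
    have h3 : ‖charFun ρ t‖ ^ 2 = 1 := by exact_mod_cast h2
    exact ht (by nlinarith [norm_nonneg (charFun ρ t)])
  obtain ⟨r₁, hr₁, hp⟩ := hlev
  set p := ρs.real {x | r₁ < |x|} with hpdef
  have hlower : ∀ k, 2 * (t₀ * r₁)⁻¹ < |f k| →
      p ≤ t₀⁻¹ * ∫ t in (-t₀)..t₀, (1 - ‖charFun ρ (f k * t)‖ ^ 2) := fun k hk => by
    have hfm : Measurable fun x : ℝ => f k * x := by fun_prop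
    have hPk : IsProbabilityMeasure (ρs.map fun x => f k * x) :=
      Measure.isProbabilityMeasure_map hfm.aemeasurable
    have h1 := measureReal_abs_gt_le_integral_charFun (μ := ρs.map fun x => f k * x)
      (r := 2 * t₀⁻¹) (by positivity)
    rw [map_measureReal_apply hfm (measurableSet_lt measurable_const (by fun_prop))] at h1
    have h2 : (2 : ℝ) * (2 * t₀⁻¹)⁻¹ = t₀ := by field_simp
    have h3 : (-2 : ℝ) * (2 * t₀⁻¹)⁻¹ = -t₀ := by rw [neg_mul, h2]
    rw [h2, h3] at h1
    have h4 : (∫ t in (-t₀)..t₀, 1 - charFun (ρs.map fun x => f k * x) t) =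
        ((∫ t in (-t₀)..t₀, (1 - ‖charFun ρ (f k * t)‖ ^ 2) : ℝ) : ℂ) := by
      rw [← intervalIntegral.integral_ofReal]
      refine intervalIntegral.integral_congr fun t _ => ?_
      simp only [charFun_map_mul, hcf]
      push_cast
      rfl
    rw [h4, Complex.norm_real, Real.norm_of_nonneg
      (intervalIntegral.integral_nonneg (by linarith) fun t _ => by
        have := norm_charFun_le_one (μ := ρ) (f k * t)
        nlinarith [norm_nonneg (charFun ρ (f k * t))])] at h1
    refine (measureReal_mono fun x hx => ?_).trans (h1.trans_eq (by ring))
    have hx' : r₁ < |x| := hx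
    show 2 * t₀⁻¹ < |f k * x|
    rw [abs_mul]
    calc 2 * t₀⁻¹ = 2 * (t₀ * r₁)⁻¹ * r₁ := by field_simp
      _ < |f k| * |x| := mul_lt_mul'' hk hx' (by positivity) hr₁.le
  refine ⟨2 * (t₀ * r₁)⁻¹, by positivity, ?_⟩
  by_contra hinf
  obtain ⟨n, hn⟩ := exists_nat_gt (6 / p)
  obtain ⟨F, hF, hcard⟩ := Set.Infinite.exists_subset_card_eq hinf n
  have hcont : ∀ k, Continuous fun t => 1 - ‖charFun ρ (f k * t)‖ ^ 2 := fun k => by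
    have : Continuous (charFun ρ) := continuous_charFun
    fun_prop
  have h1 : (n : ℝ) * p ≤ 6 := by
    calc (n : ℝ) * p = ∑ k ∈ F, p := by simp [hcard]
      _ ≤ ∑ k ∈ F, t₀⁻¹ * ∫ t in (-t₀)..t₀, (1 - ‖charFun ρ (f k * t)‖ ^ 2) :=
          Finset.sum_le_sum fun k hk => hlower k (hF hk)
      _ = t₀⁻¹ * ∫ t in (-t₀)..t₀, ∑ k ∈ F, (1 - ‖charFun ρ (f k * t)‖ ^ 2) := by
          rw [intervalIntegral.integral_finsetSum fun k _ => (hcont k).intervalIntegrable _ _,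
            Finset.mul_sum]
      _ ≤ t₀⁻¹ * ∫ t in (-t₀)..t₀, (3 : ℝ) := by
          refine mul_le_mul_of_nonneg_left ?_ (by positivity)
          refine intervalIntegral.integral_mono_on (by linarith)
            ((continuous_finsetSum F fun k _ => hcont k).intervalIntegrable _ _)
            intervalIntegrable_const fun t ht => hsum t (abs_le.2 ht) F
      _ = 6 := by
          rw [intervalIntegral.integral_const, smul_eq_mul]
          field_simp
          ring
  rw [div_lt_iff₀ hp] at hn
  linarith

/-- Almost sure convergence along one sequence of finite sets exhausting the index set forces
`f ∈ ℓ^α`. -/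
theorem summable_of_ae_exists_tendsto_sum [IsProbabilityMeasure P] {ι : Type*}
    {ξ : ι → Ω → ℝ} (hm : ∀ k, Measurable (ξ k)) (hind : iIndepFun ξ P) {ρ : Measure ℝ}
    [IsProbabilityMeasure ρ] (hρ : ∀ k, P.map (ξ k) = ρ) {α c δ : ℝ} (hc : 0 < c) (hδ : 0 < δ)
    (hlow : ∀ t : ℝ, |t| ≤ δ → c * |t| ^ α ≤ 1 - ‖charFun ρ t‖)
    {f : ι → ℝ} {S : ℕ → Finset ι} (hS : Tendsto S atTop atTop)
    (hconv : ∀ᵐ ω ∂P, ∃ l : ℝ, Tendsto (fun n => ∑ k ∈ S n, f k * ξ k ω) atTop (𝓝 l)) :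
    Summable fun k => |f k| ^ α := by
  classical
  obtain ⟨t₀, ht₀, hsum⟩ := exists_forall_sum_one_sub_norm_charFun_sq_le hm hind hρ hS hconv
  have hnd : ∃ t, ‖charFun ρ t‖ ≠ 1 := ⟨δ, fun h => by
    have h1 := hlow δ (abs_of_pos hδ).le
    rw [h, sub_self, abs_of_pos hδ] at h1
    have : 0 < c * δ ^ α := by positivity
    linarith⟩
  obtain ⟨M, hM, hfin⟩ := exists_finite_setOf_lt_abs hnd ht₀ hsum
  -- At this scale `t` the arguments `f k * t` with `|f k| ≤ M` are in the range of `hlow`.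
  set t := min t₀ (δ / M) with ht
  have ht0 : 0 < t := by positivity
  have hbd : Summable fun k => if |f k| ≤ M then |f k| ^ α else 0 := by
    refine summable_of_sum_le (c := 3 / (c * t ^ α)) (fun k => ?_) fun F => ?_
    · dsimp only [Pi.zero_apply]
      split_ifs <;> positivity
    · rw [le_div_iff₀ (by positivity), Finset.sum_mul]
      refine (Finset.sum_le_sum fun k _ => ?_).trans
        (hsum t (by rw [abs_of_pos ht0]; exact min_le_left _ _) F)
      have h1 : ‖charFun ρ (f k * t)‖ ≤ 1 := norm_charFun_le_one _
      have h2 := norm_nonneg (charFun ρ (f k * t))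
      split_ifs with hk
      · have h3 := hlow (f k * t) (by
          rw [abs_mul, abs_of_pos ht0]
          calc |f k| * t ≤ M * (δ / M) := mul_le_mul hk (min_le_right _ _) ht0.le hM.le
            _ = δ := by field_simp)
        rw [abs_mul, abs_of_pos ht0, Real.mul_rpow (abs_nonneg _) ht0.le] at h3
        nlinarith
      · nlinarith
  refine (summable_congr_cofinite ?_).1 hbd
  filter_upwards [hfin.compl_mem_cofinite] with k hk
  exact if_pos (not_lt.1 fun h : M < |f k| => hk h)

end

/-! ### Grid cells -/

lemma mem_gridCell_iff {d : ℕ} {h : ℝ} (hh : 0 < h) {k : Fin d → ℤ}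
    {x : EuclideanSpace ℝ (Fin d)} : x ∈ gridCell h k ↔ ∀ i, ⌊x i / h⌋ = k i := by
  refine forall_congr' fun i => ?_
  rw [Int.floor_eq_iff, le_div_iff₀ hh, div_lt_iff₀ hh, mul_comm, mul_comm h]

lemma gridCell_eq_preimage {d : ℕ} (h : ℝ) (k : Fin d → ℤ) :
    gridCell h k = WithLp.ofLp ⁻¹'
      (Set.univ.pi fun i => Set.Ico (h * (k i : ℝ)) (h * ((k i : ℝ) + 1))) := by
  ext x
  simp [gridCell]

lemma measurableSet_gridCell {d : ℕ} (h : ℝ) (k : Fin d → ℤ) : MeasurableSet (gridCell h k) := by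
  rw [gridCell_eq_preimage]
  exact (MeasurableSet.univ_pi fun i => measurableSet_Ico).preimage
    (PiLp.volume_preserving_ofLp (Fin d)).measurable

lemma volume_gridCell {d : ℕ} (h : ℝ) (k : Fin d → ℤ) :
    volume (gridCell h k) = ENNReal.ofReal h ^ d := by
  rw [gridCell_eq_preimage, (PiLp.volume_preserving_ofLp (Fin d)).measure_preimage
    (MeasurableSet.univ_pi fun i => measurableSet_Ico).nullMeasurableSet, Real.volume_pi_Ico]
  simp [mul_add]

lemma volume_real_gridCell {d : ℕ} {h : ℝ} (hh : 0 < h) (k : Fin d → ℤ) :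
    volume.real (gridCell h k) = h ^ d := by
  rw [measureReal_def, volume_gridCell, ENNReal.toReal_pow, ENNReal.toReal_ofReal hh.le]

lemma disjoint_gridCell {d : ℕ} {h : ℝ} (hh : 0 < h) {k l : Fin d → ℤ} (hkl : k ≠ l) :
    Disjoint (gridCell h k) (gridCell h l) :=
  Set.disjoint_left.2 fun _ hk hl => hkl (funext fun i =>
    ((mem_gridCell_iff hh).1 hk i).symm.trans ((mem_gridCell_iff hh).1 hl i))

lemma norm_sub_le_of_mem_gridCell {d : ℕ} {h : ℝ} {k : Fin d → ℤ}
    {x y : EuclideanSpace ℝ (Fin d)} (hx : x ∈ gridCell h k) (hy : y ∈ gridCell h k) :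
    ‖x - y‖ ≤ √(d * h ^ 2) := by
  rw [EuclideanSpace.norm_eq]
  refine Real.sqrt_le_sqrt ?_
  calc ∑ i, ‖(x - y) i‖ ^ 2 ≤ ∑ _i : Fin d, h ^ 2 := by
        refine Finset.sum_le_sum fun i _ => ?_
        rw [Real.norm_eq_abs, sq_abs]
        refine sq_le_sq' ?_ ?_ <;> simp only [PiLp.sub_apply] <;> linarith [hx i, hy i]
    _ = d * h ^ 2 := by simp

lemma integrableOn_gridCell {d : ℕ} {h : ℝ} {f : EuclideanSpace ℝ (Fin d) → ℝ}
    (hf : LocallyIntegrable f volume) (k : Fin d → ℤ) : IntegrableOn f (gridCell h k) := by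
  have hK : IsCompact (WithLp.toLp 2 ''
      Set.Icc (fun i => h * (k i : ℝ)) (fun i => h * ((k i : ℝ) + 1))) :=
    isCompact_Icc.image (PiLp.continuous_toLp 2 fun _ : Fin d => ℝ)
  exact (hf.integrableOn_isCompact hK).mono_set fun x hx =>
    ⟨x.ofLp, ⟨fun i => (hx i).1, fun i => (hx i).2.le⟩, rfl⟩

lemma summable_setIntegral_gridCell {d : ℕ} {h : ℝ} (hh : 0 < h)
    {g : EuclideanSpace ℝ (Fin d) → ℝ} (hg : Integrable g) :
    Summable fun k : Fin d → ℤ => ∫ x in gridCell h k, g x :=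
  (hasSum_integral_iUnion (measurableSet_gridCell h) (fun _ _ => disjoint_gridCell hh)
    hg.integrableOn).summable

/-- Only finitely many cells meet a given ball. -/
lemma eventually_cofinite_forall_mem_gridCell_le_norm {d : ℕ} {h : ℝ} (hh : 0 < h) (R : ℝ) :
    ∀ᶠ k : Fin d → ℤ in cofinite, ∀ x ∈ gridCell h k, R ≤ ‖x‖ := by
  refine ((Fintype.piFinset fun _ : Fin d =>
    Finset.Icc ⌊-R / h⌋ ⌊R / h⌋).finite_toSet.subset ?_ : Set.Finite _)
  intro k hk
  have hk' : ¬ ∀ x ∈ gridCell h k, R ≤ ‖x‖ := hk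
  push Not at hk'
  obtain ⟨x, hx, hxR⟩ := hk'
  simp only [Finset.mem_coe, Fintype.mem_piFinset, Finset.mem_Icc]
  intro i
  rw [← (mem_gridCell_iff hh).1 hx i]
  have hxi : |x i| ≤ R := (PiLp.norm_apply_le x i).trans hxR.le
  rw [abs_le] at hxi
  exact ⟨Int.floor_le_floor (by gcongr; exact hxi.1), Int.floor_le_floor (by gcongr; exact hxi.2)⟩

/-! ### The integrands of the grid measures -/

lemma gridDensity_of_mem_gridCell {Ω : Type*} {d : ℕ} {α σ h : ℝ} (hh : 0 < h)
    (ξ : (Fin d → ℤ) → Ω → ℝ) (ω : Ω) {k : Fin d → ℤ} {x : EuclideanSpace ℝ (Fin d)} (hx : x ∈ gridCell h k) :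
    gridDensity α σ h ξ ω x = gridNorm d α σ h * ξ k ω := by
  rw [gridDensity, tsum_eq_single k, Set.indicator_of_mem hx]
  exact fun l hl => Set.indicator_of_notMem
    (fun hxl => Set.disjoint_left.1 (disjoint_gridCell hh hl) hxl hx) _

lemma gridIntegralOn_biUnion_gridCell {Ω : Type*} {d : ℕ} {α σ h : ℝ} (hh : 0 < h)
    (ξ : (Fin d → ℤ) → Ω → ℝ) {f : EuclideanSpace ℝ (Fin d) → ℝ}
    (hf : LocallyIntegrable f volume) (F : Finset (Fin d → ℤ)) (ω : Ω) :
    gridIntegralOn α σ h ξ f (⋃ k ∈ F, gridCell h k) ω =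
      ∑ k ∈ F, (gridNorm d α σ h * ∫ x in gridCell h k, f x) * ξ k ω := by
  have heq : ∀ k, Set.EqOn (fun x => f x * (gridNorm d α σ h * ξ k ω))
      (fun x => f x * gridDensity α σ h ξ ω x) (gridCell h k) := fun k x hx => by
    simp only [gridDensity_of_mem_gridCell hh ξ ω hx]
  rw [gridIntegralOn, integral_biUnion_finset F (fun k _ => measurableSet_gridCell h k)
    (fun k _ l _ hkl => disjoint_gridCell hh hkl) fun k _ =>
      IntegrableOn.congr_fun ((integrableOn_gridCell hf k).mul_const _) (heq k)
        (measurableSet_gridCell h k)]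
  refine Finset.sum_congr rfl fun k _ => ?_
  rw [← setIntegral_congr_fun (measurableSet_gridCell h k) (heq k), integral_mul_const]
  ring

/-- Jensen's inequality on each cell: the cell integrals of `f ∈ L^α` are in `ℓ^α`. -/
lemma summable_abs_setIntegral_gridCell_of_memLp {d : ℕ} {α h : ℝ} (hα : 1 ≤ α) (hh : 0 < h)
    {f : EuclideanSpace ℝ (Fin d) → ℝ} (hf : MemLp f (ENNReal.ofReal α) volume) :
    Summable fun k : Fin d → ℤ => |∫ x in gridCell h k, f x| ^ α := by
  have hα0 : 0 < α := by linarith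
  have hloc : LocallyIntegrable f volume := hf.locallyIntegrable (by simpa using hα)
  have hint : Integrable fun x => |f x| ^ α := by
    have := hf.integrable_norm_rpow (by simpa using hα0) ENNReal.ofReal_ne_top
    simpa only [ENNReal.toReal_ofReal hα0.le, Real.norm_eq_abs] using this
  have hV : 0 < h ^ d := by positivity
  refine Summable.of_nonneg_of_le (fun k => by positivity) (fun k => ?_)
    ((summable_setIntegral_gridCell hh hint).mul_left ((h ^ d) ^ α * (h ^ d)⁻¹))
  have hjensen := (convexOn_rpow hα).map_set_average_le (μ := volume) (t := gridCell h k)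
    (f := fun x => |f x|) (Real.continuous_rpow_const hα0.le).continuousOn isClosed_Ici
    (by rw [volume_gridCell]; exact pow_ne_zero _ (by simpa using hh))
    (by rw [volume_gridCell]; exact ENNReal.pow_ne_top ENNReal.ofReal_ne_top)
    (ae_of_all _ fun x => abs_nonneg (f x)) (integrableOn_gridCell hloc k).abs
    hint.integrableOn
  simp only [setAverage_eq, volume_real_gridCell hh, smul_eq_mul] at hjensen
  have hI : 0 ≤ ∫ x in gridCell h k, |f x| := integral_nonneg fun x => abs_nonneg _
  calc |∫ x in gridCell h k, f x| ^ α ≤ (∫ x in gridCell h k, |f x|) ^ α :=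
        Real.rpow_le_rpow (abs_nonneg _) abs_integral_le_integral_abs hα0.le
    _ = (h ^ d) ^ α * ((h ^ d)⁻¹ * ∫ x in gridCell h k, |f x|) ^ α := by
        rw [← Real.mul_rpow hV.le (by positivity), mul_inv_cancel_left₀ hV.ne']
    _ ≤ (h ^ d) ^ α * ((h ^ d)⁻¹ * ∫ x in gridCell h k, |f x| ^ α) := by gcongr
    _ = _ := by ring

/-- For `f` in the decay class, the cell integrals are dominated, off finitely many cells, by the
cell integrals of the integrable function `(1 + ‖x‖) ^ (-η α)`. -/
lemma summable_abs_setIntegral_gridCell_of_mem_decayClass {d : ℕ} {α h : ℝ} (hα : 0 < α)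
    (hh : 0 < h) {f : EuclideanSpace ℝ (Fin d) → ℝ} (hf : f ∈ decayClass d α) :
    Summable fun k : Fin d → ℤ => |∫ x in gridCell h k, f x| ^ α := by
  obtain ⟨hloc, η, hη, hlo⟩ := hf
  have hη0 : 0 < η := lt_of_le_of_lt (by positivity) hη
  have hdη : (d : ℝ) < η * α := by rwa [div_lt_iff₀ hα] at hη
  set D := √(d * h ^ 2) with hD
  have hD0 : 0 ≤ D := Real.sqrt_nonneg _
  have hV : 0 < h ^ d := by positivity
  have hfin : ∀ k : Fin d → ℤ, volume (gridCell h k) < ⊤ := fun k => by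
    rw [volume_gridCell]
    exact ENNReal.pow_lt_top ENNReal.ofReal_lt_top
  have hw : Integrable fun x : EuclideanSpace ℝ (Fin d) => (1 + ‖x‖) ^ (-(η * α)) :=
    integrable_one_add_norm (by simpa using hdη)
  obtain ⟨R, hR⟩ : ∃ R : ℝ, ∀ x : EuclideanSpace ℝ (Fin d), R ≤ ‖x‖ →
      |f x| ≤ ‖x‖ ^ (-η) := by
    have h1 := hlo.bound (c := 1) one_pos
    rw [← Metric.cobounded_eq_cocompact, hasBasis_cobounded_norm.eventually_iff] at h1
    obtain ⟨R, -, hR⟩ := h1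
    refine ⟨R, fun x hx => ?_⟩
    have := hR hx
    rwa [one_mul, Real.norm_eq_abs, Real.norm_of_nonneg (by positivity)] at this
  set A := h ^ d * (2 + D) ^ η with hA
  have hA0 : 0 < A := by positivity
  refine Summable.of_norm_bounded_eventually
    (((summable_setIntegral_gridCell hh hw).mul_left ((h ^ d)⁻¹ * A ^ α))) ?_
  filter_upwards [eventually_cofinite_forall_mem_gridCell_le_norm hh (max R 1)] with k hk
  rw [Real.norm_of_nonneg (by positivity)]
  have hpt : ∀ x ∈ gridCell h k,
      |∫ y in gridCell h k, f y| ^ α ≤ A ^ α * (1 + ‖x‖) ^ (-(η * α)) := by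
    intro x hx
    have hbound : ∀ y ∈ gridCell h k, ‖f y‖ ≤ (2 + D) ^ η * (1 + ‖x‖) ^ (-η) := by
      intro y hy
      have hy1 := (le_max_right R 1).trans (hk y hy)
      have hxy : 1 + ‖x‖ ≤ (2 + D) * ‖y‖ := by
        have h1 := norm_sub_le_of_mem_gridCell hx hy
        have h2 := norm_le_norm_add_norm_sub' x y
        nlinarith
      calc ‖f y‖ ≤ ‖y‖ ^ (-η) := hR y ((le_max_left R 1).trans (hk y hy))
        _ = (2 + D) ^ η * ((2 + D) * ‖y‖) ^ (-η) := by
            rw [Real.mul_rpow (by positivity) (by positivity), ← mul_assoc,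
              ← Real.rpow_add (by positivity), add_neg_cancel, Real.rpow_zero, one_mul]
        _ ≤ (2 + D) ^ η * (1 + ‖x‖) ^ (-η) := by
            gcongr (2 + D) ^ η * ?_
            exact Real.rpow_le_rpow_of_nonpos (by positivity) hxy (by linarith)
    have h1 := norm_setIntegral_le_of_norm_le_const (hfin k) hbound
    rw [volume_real_gridCell hh, Real.norm_eq_abs] at h1
    calc |∫ y in gridCell h k, f y| ^ α ≤ (A * (1 + ‖x‖) ^ (-η)) ^ α := by
          refine Real.rpow_le_rpow (abs_nonneg _) (h1.trans_eq ?_) hα.le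
          rw [hA]
          ring
      _ = A ^ α * (1 + ‖x‖) ^ (-(η * α)) := by
          rw [Real.mul_rpow hA0.le (by positivity), ← Real.rpow_mul (by positivity), neg_mul]
  have hmean : h ^ d * |∫ y in gridCell h k, f y| ^ α ≤
      ∫ x in gridCell h k, A ^ α * (1 + ‖x‖) ^ (-(η * α)) := by
    have := setIntegral_mono_on (μ := volume) (s := gridCell h k)
      (integrableOn_const (hfin k).ne) (hw.const_mul (A ^ α)).integrableOn
      (measurableSet_gridCell h k) hpt
    rwa [setIntegral_const, volume_real_gridCell hh, smul_eq_mul] at this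
  rw [integral_const_mul] at hmean
  rw [mul_assoc, ← div_eq_inv_mul, le_div_iff₀ hV]
  linarith

theorem mainTheorem8 {Ω : Type*} [MeasurableSpace Ω] (P : Measure Ω) [IsProbabilityMeasure P]
    (d : ℕ) (α σ ν : ℝ) (hα : 0 < α) (hα2 : α ≤ 2) (hσ : 0 < σ) (hν : ν ∈ Set.Icc (-1 : ℝ) 1)
    (hν1 : α = 1 → ν = 0) (ξ : (Fin d → ℤ) → Ω → ℝ) (hξ : HypH α σ ν ξ P) :
    -- the integrands of `∑ ξ_k δ_k` are exactly the sequences in `ℓ^α`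
    latticeIntegrands P ξ = ellSpace d α ∧
    -- and this is so for any order of summation fixed in advance
    (∀ S : ℕ → Finset (Fin d → ℤ), IsExhaustion S → ∀ f : (Fin d → ℤ) → ℝ,
      (∀ᵐ ω ∂P, ∃ l : ℝ, Tendsto (fun n => ∑ k ∈ S n, f k * ξ k ω) atTop (𝓝 l)) ↔
        f ∈ ellSpace d α) ∧
    -- the integrands of the grid measures
    (1 ≤ α → ∀ h : ℝ, 0 < h → ∀ f : EuclideanSpace ℝ (Fin d) → ℝ,
      MemLp f (ENNReal.ofReal α) volume → f ∈ gridIntegrands P α σ h ξ) ∧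
    (α < 1 → ∀ h : ℝ, 0 < h → decayClass d α ⊆ gridIntegrands P α σ h ξ) := by
  obtain ⟨ρ, hρ, hdom⟩ := hξ.law
  obtain ⟨C, hC0, hC⟩ := hdom.exists_norm_one_sub_charFun_le hα
  obtain ⟨c, hc, δ, hδ, hlow⟩ := hdom.exists_mul_rpow_le_one_sub_norm_charFun hα hσ
  have hsuff : ∀ f ∈ ellSpace d α, SemiConvergesAS P fun F ω => ∑ k ∈ F, f k * ξ k ω :=
    fun f hf => semiConvergesAS_of_iIndepFun (fun k => (hξ.measurable k).const_mul (f k))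
      (hξ.indep.comp (fun k x => f k * x) fun k => by fun_prop) fun r hr ε hε =>
        exists_finset_forall_disjoint_measureReal_le hξ.measurable hξ.indep hρ hα hC0 hC hf hr hε
  have hnec : ∀ S : ℕ → Finset (Fin d → ℤ), IsExhaustion S → ∀ f : (Fin d → ℤ) → ℝ,
      (∀ᵐ ω ∂P, ∃ l : ℝ, Tendsto (fun n => ∑ k ∈ S n, f k * ξ k ω) atTop (𝓝 l)) →
        f ∈ ellSpace d α := fun S hS f hf =>
    summable_of_ae_exists_tendsto_sum hξ.measurable hξ.indep hρ hc hδ hlow hS.tendsto_atTop hf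
  have hgrid : ∀ h : ℝ, 0 < h → ∀ f : EuclideanSpace ℝ (Fin d) → ℝ,
      LocallyIntegrable f volume →
        (Summable fun k : Fin d → ℤ => |∫ x in gridCell h k, f x| ^ α) →
          f ∈ gridIntegrands P α σ h ξ := fun h hh f hloc hf => by
    refine ⟨hloc, ?_⟩
    simp only [gridIntegralOn_biUnion_gridCell hh ξ hloc]
    refine hsuff _ ?_
    have h1 := hf.mul_left (|gridNorm d α σ h| ^ α)
    simp only [← Real.mul_rpow (abs_nonneg _) (abs_nonneg _), ← abs_mul] at h1
    exact h1
  refine ⟨Set.Subset.antisymm (fun f hf => ?_) hsuff, fun S hS f => ⟨hnec S hS f, fun hf => ?_⟩,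
    fun hα1 h hh f hf => hgrid h hh f (hf.locallyIntegrable (by simpa using hα1))
      (summable_abs_setIntegral_gridCell_of_memLp hα1 hh hf),
    fun _ h hh f hf => hgrid h hh f hf.1
      (summable_abs_setIntegral_gridCell_of_mem_decayClass hα hh hf)⟩
  · obtain ⟨X, -, hX⟩ := hf
    exact hnec _ (isExhaustion_box d) f
      ((hX _ (isExhaustion_box d)).mono fun ω hω => ⟨X ω, hω⟩)
  · obtain ⟨X, -, hX⟩ := hsuff f hf
    exact (hX S hS).mono fun ω hω => ⟨X ω, hω⟩
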